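/- Let $V=\bigoplus_{i\ge 0}\mathbb{Q}\,b_i$ be the $\mathbb{Q}$-vector space with basis $(b_i)_{i\ge 0}$ and let $\bigwedge V=\bigoplus_{k\ge 0}\bigwedge^kV$ be its exterior algebra. For $\phi\in\mathrm{End}_{\mathbb Q}(V)$ let $\delta(\phi)$ be the unique $\mathbb{Q}$-linear endomorphism of $\bigwedge V$ with $\delta(\phi)(u\wedge v)=\delta(\phi)u\wedge v+u\wedge\delta(\phi)v$ for all $u,v\in\bigwedge V$ and $\delta(\phi)|_V=\phi$. Let $\sigma_1:V\to V$ be the linear map with $\sigma_1b_j=b_{j+1}$, and put $$\sigma_+(z):=\exp\Big(\sum_{i\ge 1}\frac1i\,\delta(\sigma_1^i)z^i\Big)\in\mathrm{End}_{\mathbb Q}\big(\bigwedge V\big)[[z]],\qquad \sigma_+(\mathbf z_k):=\sigma_+(z_1)\cdots\sigma_+(z_k)\in\mathrm{End}_{\mathbb Q}\big(\bigwedge V\big)[[z_1,\dots,z_k]].$$ Let $\mathcal P_k$ be the set of partitions $\mu=(\mu_1\ge\dots\ge\mu_k\ge 0)$ of length at most $k$, and for $\mu\in\mathcal P_k$ let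 $$[\mathbf b]^k_\mu:=b_{k-1+\mu_1}\wedge b_{k-2+\mu_2}\wedge\cdots\wedge b_{\mu_k},$$ with $[\mathbf b]^k_0$ the one for $\mu=(0,\dots,0)$. Let $s_\mu(\mathbf z_k)\in\mathbb Q[z_1,\dots,z_k]$ be the Schur polynomial, that is, the unique polynomial with $\Delta_\mu(\mathbf z_k)=s_\mu(\mathbf z_k)\,\Delta_0(\mathbf z_k)$, where $\Delta_\mu(\mathbf z_k)=\det\big(z_j^{\mu_{k-i+1}+i-1}\big)_{1\le i,j\le k}$. Then, for every $k\ge 0$, the family $([\mathbf b]^k_\mu)_{\mu\in\mathcal P_k}$ is a $\mathbb Q$-basis of $\bigwedge^kV$, and its generating function is $$\sum_{\mu\in\mathcal P_k}s_\mu(\mathbf z_k)\,[\mathbf b]^k_\mu=\sigma_+(\mathbf z_k)[\mathbf b]^k_0$$ as formal power series in $z_1,\dots,z_k$ with coefficients in $\bigwedge V$ (for each monomial in $z_1,\dots,z_k$ only finitely many summands on the left have a nonzero coefficient). -/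

import Mathlib

namespace SchubertGen

noncomputable section

/-- The vector space `V = ⨁_{i ≥ 0} ℚ · b_i`. -/
abbrev V : Type := ℕ →₀ ℚ

/-- The basis vector `b_i` of `V`. -/
def b (i : ℕ) : V := Finsupp.single i 1

/-- The exterior algebra `⋀ V`. -/
abbrev ExtV : Type := ExteriorAlgebra ℚ V

/-- Partitions of length at most `k`, written as `μ 0 ≥ μ 1 ≥ ⋯ ≥ μ (k - 1) ≥ 0`. -/
abbrev Parts (k : ℕ) : Type := {μ : Fin k → ℕ // Antitone μ}

/-- The zero partition. -/
def zeroPart (k : ℕ) : Parts k := ⟨fun _ => 0, fun _ _ _ => le_rfl⟩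

/-- `[b]^k_μ = b_{k-1+μ_1} ∧ b_{k-2+μ_2} ∧ ⋯ ∧ b_{μ_k}` (here the parts are numbered from `0`). -/
def wedgeB {k : ℕ} (μ : Parts k) : ExtV :=
  ExteriorAlgebra.ιMulti ℚ k (fun i : Fin k => b (k - 1 - (i : ℕ) + μ.1 i))

/-! ### Schur polynomials as quotients of alternants -/

/-- `Δ_μ(x_1, …, x_k) = det (x_j ^ (μ_{k-i+1} + i - 1))_{i, j}`. -/
def alternant {k : ℕ} (μ : Parts k) : MvPolynomial (Fin k) ℚ :=
  Matrix.det (Matrix.of fun i j : Fin k =>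
    (MvPolynomial.X j : MvPolynomial (Fin k) ℚ) ^ (μ.1 (Fin.rev i) + (i : ℕ)))

/-- The alternant of the zero partition is the (transposed) Vandermonde determinant. -/
theorem alternant_zero (k : ℕ) : alternant (zeroPart k) =
    ((Matrix.vandermonde
      (fun j : Fin k => (MvPolynomial.X j : MvPolynomial (Fin k) ℚ))).transpose).det := by
  unfold alternant zeroPart
  congr 1
  ext i j
  simp [Matrix.vandermonde]

theorem alternant_zero_ne_zero (k : ℕ) : alternant (zeroPart k) ≠ 0 := by
  rw [alternant_zero, Matrix.det_transpose, Matrix.det_vandermonde_ne_zero_iff]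
  exact MvPolynomial.X_injective

/-- Every alternant is divisible, in a unique way, by the Vandermonde determinant. -/
theorem existsUnique_schur {k : ℕ} (μ : Parts k) :
    ∃! s : MvPolynomial (Fin k) ℚ, alternant μ = s * alternant (zeroPart k) := by
  classical
  refine existsUnique_of_exists_of_unique ?_ fun s t hs ht =>
    mul_right_cancel₀ (alternant_zero_ne_zero k) (hs.symm.trans ht)
  set P : Polynomial (MvPolynomial (Fin k) ℚ) :=
    ∏ j : Fin k, (Polynomial.X - Polynomial.C (MvPolynomial.X j)) with hP
  have hmonic : P.Monic := Polynomial.monic_prod_of_monic _ _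
    fun j _ => Polynomial.monic_X_sub_C _
  have hdeg : P.natDegree = k := by
    rw [hP, Polynomial.natDegree_prod_of_monic _ _ fun j _ => Polynomial.monic_X_sub_C _]
    simp
  let r : ℕ → Polynomial (MvPolynomial (Fin k) ℚ) := fun n => (Polynomial.X ^ n) %ₘ P
  have hr : ∀ (n : ℕ) (j : Fin k), (MvPolynomial.X j : MvPolynomial (Fin k) ℚ) ^ n =
      ∑ m : Fin k, (r n).coeff m * MvPolynomial.X j ^ (m : ℕ) := by
    intro n j
    have hroot : P.eval (MvPolynomial.X j) = 0 := by
      rw [hP, Polynomial.eval_prod]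
      exact Finset.prod_eq_zero (Finset.mem_univ j) (by simp)
    have h1 := congrArg (Polynomial.eval (MvPolynomial.X j))
      (Polynomial.modByMonic_add_div (Polynomial.X ^ n) P)
    rw [Polynomial.eval_add, Polynomial.eval_mul, hroot, zero_mul, add_zero,
      Polynomial.eval_pow, Polynomial.eval_X] at h1
    rw [← h1]
    have hlt : (r n).natDegree < k ∨ k = 0 := by
      rcases Nat.eq_zero_or_pos k with h | h
      · exact Or.inr h
      · left
        have := Polynomial.natDegree_modByMonic_lt (Polynomial.X ^ n) hmonic
          (by rintro h2; rw [h2] at hdeg; simp at hdeg; omega)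
        simpa [r, hdeg] using this
    rcases hlt with hlt | h0
    · rw [Polynomial.eval_eq_sum_range' hlt, Finset.sum_range]
    · exact absurd j.2 (by omega)
  refine ⟨Matrix.det (Matrix.of fun i m : Fin k =>
    (r (μ.1 (Fin.rev i) + (i : ℕ))).coeff (m : ℕ)), ?_⟩
  unfold alternant
  rw [← Matrix.det_mul]
  congr 1
  ext1 i j
  rw [Matrix.mul_apply]
  simp only [Matrix.of_apply]
  rw [hr]
  simp [zeroPart]

/-- The Schur polynomial `s_μ(x_1, …, x_k)`: the polynomial with `Δ_μ = s_μ · Δ_0`. -/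
def schur {k : ℕ} (μ : Parts k) : MvPolynomial (Fin k) ℚ := (existsUnique_schur μ).choose

theorem schur_spec {k : ℕ} (μ : Parts k) :
    alternant μ = schur μ * alternant (zeroPart k) := (existsUnique_schur μ).choose_spec.1

/-! ### The derivation of the exterior algebra induced by an endomorphism of `V` -/

/-- The algebra homomorphism `⋀ V → ⋀ V [ε]` with `v ↦ v + ε φ(v)` for `v ∈ V`. -/
def deltaHom (φ : Module.End ℚ V) : ExtV →ₐ[ℚ] DualNumber ExtV :=
  ExteriorAlgebra.lift ℚ
    ⟨(TrivSqZeroExt.inlAlgHom ℚ ExtV ExtV).toLinearMap ∘ₗ ExteriorAlgebra.ι ℚ +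
      (TrivSqZeroExt.inrHom ExtV ExtV).restrictScalars ℚ ∘ₗ ExteriorAlgebra.ι ℚ ∘ₗ φ, by
      intro v
      ext
      · simp
      · have h := ExteriorAlgebra.ι_add_mul_swap (R := ℚ) v (φ v)
        simp [h]⟩

/-- `δ(φ)`: the derivation of `⋀ V` that restricts to `φ` on `V`. -/
def delta (φ : Module.End ℚ V) : Module.End ℚ ExtV :=
  (TrivSqZeroExt.sndHom ExtV ExtV).restrictScalars ℚ ∘ₗ (deltaHom φ).toLinearMap

theorem deltaHom_fst (φ : Module.End ℚ V) (u : ExtV) : (deltaHom φ u).fst = u := by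
  have h : (TrivSqZeroExt.fstHom ℚ ExtV ExtV).comp (deltaHom φ) = AlgHom.id ℚ ExtV := by
    apply ExteriorAlgebra.hom_ext
    ext v
    simp [deltaHom]
  exact DFunLike.congr_fun h u

theorem delta_ι (φ : Module.End ℚ V) (v : V) :
    delta φ (ExteriorAlgebra.ι ℚ v) = ExteriorAlgebra.ι ℚ (φ v) := by
  simp [delta, deltaHom]

theorem delta_mul (φ : Module.End ℚ V) (u w : ExtV) :
    delta φ (u * w) = delta φ u * w + u * delta φ w := by
  have h : ∀ x : ExtV, delta φ x = (deltaHom φ x).snd := fun x => rfl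
  rw [h, h, h, map_mul, TrivSqZeroExt.snd_mul, deltaHom_fst, deltaHom_fst]
  simp [add_comm]

/-! ### The Schubert derivation -/

/-- The shift `σ_1 : V → V`, `b_j ↦ b_{j+1}`. -/
def shift : Module.End ℚ V := Finsupp.lmapDomain ℚ ℚ (fun j => j + 1)

theorem shift_b (j : ℕ) : shift (b j) = b (j + 1) := by
  simp [shift, b]

/-- The exponential `∑_n S^n / n!` of a power series `S` without constant term over a `ℚ`-algebra:
as `S^n` starts in degree `n`, only `n ≤ m` contribute to the coefficient of `z^m`. -/
def expSeries {A : Type*} [Ring A] [Algebra ℚ A] (S : PowerSeries A) : PowerSeries A :=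
  PowerSeries.mk fun m =>
    ∑ n ∈ Finset.range (m + 1), (1 / (n.factorial : ℚ)) • PowerSeries.coeff m (S ^ n)

/-- `σ_+(z) = exp (∑_{i ≥ 1} (1/i) δ(σ_1^i) z^i)`, a power series over `End_ℚ (⋀ V)`. -/
def sigmaPlus : PowerSeries (Module.End ℚ ExtV) :=
  expSeries (PowerSeries.mk fun i =>
    if i = 0 then 0 else (1 / (i : ℚ)) • delta (shift ^ i))

/-- The series `D(z_j)` in the variables `z_1, …, z_k` obtained from a series `D(z)`. -/
def inVar {A : Type*} [Semiring A] {k : ℕ} (j : Fin k) (D : PowerSeries A) :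
    MvPowerSeries (Fin k) A :=
  fun m => if m = Finsupp.single j (m j) then PowerSeries.coeff (m j) D else 0

/-- `σ_+(z_1, …, z_k) = σ_+(z_1) ⋯ σ_+(z_k)`. -/
def sigmaPlusMulti (k : ℕ) : MvPowerSeries (Fin k) (Module.End ℚ ExtV) :=
  (List.ofFn fun j : Fin k => inVar j sigmaPlus).prod

/-- The value `D u ∈ A⟦z⟧` at `u ∈ A` of a power series `D` over `End_ℚ A`. -/
def applySeries {σ A : Type*} [AddCommGroup A] [Module ℚ A]
    (D : MvPowerSeries σ (Module.End ℚ A)) (u : A) : MvPowerSeries σ A :=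
  fun m => (MvPowerSeries.coeff m D) u

/-- The product `p · u ∈ A⟦z⟧` of a polynomial `p ∈ ℚ[z]` and a vector `u ∈ A`. -/
def polySMul {σ A : Type*} [AddCommGroup A] [Module ℚ A]
    (p : MvPolynomial σ ℚ) (u : A) : MvPowerSeries σ A :=
  fun m => MvPolynomial.coeff m p • u

open scoped MvPowerSeries.WithPiTopology in
/-- `g = ∑_i f_i` as formal power series: the unconditional sum for the topology of
coefficientwise convergence, the coefficients being discrete. So for each monomial all but
finitely many `f_i` have coefficient zero, and the others add up to the coefficient of `g`. -/
def HasFormalSum {ι σ A : Type*} [AddCommGroup A]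
    (f : ι → MvPowerSeries σ A) (g : MvPowerSeries σ A) : Prop :=
  letI : TopologicalSpace A := ⊥
  HasSum f g

end

end SchubertGen

/-! The operator `δ(φ)` is a derivation, so its exponential series `σ_+(z)` acts multiplicatively
from `⋀ V` to `⋀ V⟦z⟧`; it sends `b_j` to `∑ z^n b_{j+n}`. Both facts follow by induction on `n`
from `n σ_n = ∑_{i ≥ 1} δ(σ_1^i) σ_{n-i}`, which comes from applying `z d/dz` to the exponential
(`nsmul_sigmaCoeff`). Hence `σ_+(z_1, …, z_k)` is multiplicative too and sends `b_j` to `∑ h_n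
b_{j+n}`, with `h_n` complete homogeneous. On `[b]^k_0` this gives a wedge of `k` such series, in
which `[b]^k_μ` has as coefficient a determinant in the `h_n` (`wedgeCoord_sigmaPlusMulti`). By
Jacobi–Trudi (`schur_eq_det`) that determinant is `s_μ`. -/

namespace SchubertGen

open Finset

/-! ### The wedge basis of the exterior power and its coordinate functionals. -/

/-- The basis indices occurring in `wedgeB μ`. -/
def wedgeIndex {k : ℕ} (μ : Parts k) (i : Fin k) : ℕ := k - 1 - (i : ℕ) + μ.1 i

theorem wedgeB_eq {k : ℕ} (μ : Parts k) :
    wedgeB μ = ExteriorAlgebra.ιMulti ℚ k (fun i => b (wedgeIndex μ i)) := rfl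

theorem wedgeIndex_strictAnti {k : ℕ} (μ : Parts k) : StrictAnti (wedgeIndex μ) := by
  intro i j hij
  have h := μ.2 hij.le
  have hj := j.2
  have : (i : ℕ) < j := hij
  unfold wedgeIndex
  omega

theorem wedgeIndex_injective {k : ℕ} : Function.Injective (wedgeIndex (k := k)) := by
  intro μ ν h
  ext i
  have := congrFun h i
  unfold wedgeIndex at this
  omega

theorem exists_wedgeIndex_eq {k : ℕ} {g : Fin k → ℕ} (hg : StrictAnti g) :
    ∃ μ : Parts k, wedgeIndex μ = g := by
  -- There are `k - 1 - i` smaller values after `g i`, so the subtraction that defines the part is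
  -- not truncated.
  have key : ∀ n, ∀ i : Fin k, k - 1 - (i : ℕ) = n → n ≤ g i := by
    intro n
    induction n with
    | zero => intros; exact Nat.zero_le _
    | succ n ih =>
      intro i hi
      have h1 : (i : ℕ) + 1 < k := by omega
      have h2 := ih ⟨i + 1, h1⟩ (by simp only; omega)
      have h3 : g ⟨i + 1, h1⟩ < g i := hg (by simp [Fin.lt_def])
      omega
  refine ⟨⟨fun i => g i - (k - 1 - (i : ℕ)), ?_⟩, ?_⟩
  · rcases k with _ | k
    · exact fun i => i.elim0
    · rw [Fin.antitone_iff_succ_le]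
      intro i
      have h : g i.succ < g i.castSucc := hg (Fin.castSucc_lt_succ)
      have := i.2
      simp only [Fin.val_succ, Fin.val_castSucc]
      omega
  · funext i
    have := key _ i rfl
    simp only [wedgeIndex]
    omega

/-- The linear functional on `⋀ V` that reads off the coefficient of `wedgeB μ`. -/
noncomputable def wedgeCoord {k : ℕ} (μ : Parts k) : ExtV →ₗ[ℚ] ℚ :=
  ExteriorAlgebra.liftAlternating (Pi.single k
    (Matrix.detRowAlternating.compLinearMap
      (LinearMap.pi fun j : Fin k => Finsupp.lapply (wedgeIndex μ j))))

theorem wedgeCoord_ιMulti {k : ℕ} (μ : Parts k) (f : Fin k → ℕ) :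
    wedgeCoord μ (ExteriorAlgebra.ιMulti ℚ k fun i => b (f i)) =
      Matrix.det (Matrix.of fun i j : Fin k =>
        if f i = wedgeIndex μ j then (1 : ℚ) else 0) := by
  rw [wedgeCoord, ExteriorAlgebra.liftAlternating_apply_ιMulti, Pi.single_eq_same]
  change Matrix.det _ = _
  congr 1
  ext i j
  simp [b, Finsupp.single_apply]

theorem wedgeCoord_wedgeB {k : ℕ} (μ ν : Parts k) :
    wedgeCoord μ (wedgeB ν) = if μ = ν then 1 else 0 := by
  rw [wedgeB_eq, wedgeCoord_ιMulti]
  split_ifs with h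
  · subst h
    rw [← Matrix.det_one (n := Fin k)]
    congr 1
    ext i j
    simp [Matrix.one_apply, (wedgeIndex_strictAnti μ).injective.eq_iff]
  · rw [Matrix.det_apply]
    refine Finset.sum_eq_zero fun π _ => ?_
    by_contra hne
    have hall : ∀ i, wedgeIndex ν (π i) = wedgeIndex μ i := by
      intro i
      by_contra hi
      exact hne (by rw [Finset.prod_eq_zero (Finset.mem_univ i) (by simp [hi]), smul_zero])
    apply h
    apply wedgeIndex_injective
    -- A nonzero term of the determinant makes the two index sets equal, and a strictly monotone
    -- sequence is determined by its range; `Fin.rev` turns decreasing into increasing.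
    have hr : Set.range (wedgeIndex μ) = Set.range (wedgeIndex ν) := by
      rw [← funext hall]
      exact π.surjective.range_comp (wedgeIndex ν)
    have h2 := (StrictMono.range_inj (f := wedgeIndex μ ∘ Fin.rev) (g := wedgeIndex ν ∘ Fin.rev)
      ((wedgeIndex_strictAnti μ).comp Fin.rev_strictAnti)
      ((wedgeIndex_strictAnti ν).comp Fin.rev_strictAnti)).1
      (by rw [Fin.rev_surjective.range_comp, Fin.rev_surjective.range_comp, hr])
    exact Fin.rev_surjective.injective_comp_right h2

theorem wedgeB_linearIndependent (k : ℕ) :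
    LinearIndependent ℚ (fun μ : Parts k => wedgeB μ) := by
  rw [linearIndependent_iff']
  intro s g hg μ hμ
  have h := congrArg (wedgeCoord μ) hg
  simpa [wedgeCoord_wedgeB, hμ] using h

theorem ιMulti_b_mem_span {k : ℕ} {f : Fin k → ℕ} (hf : Function.Injective f) :
    ExteriorAlgebra.ιMulti ℚ k (fun i => b (f i)) ∈
      Submodule.span ℚ (Set.range fun μ : Parts k => wedgeB μ) := by
  set π : Equiv.Perm (Fin k) := Fin.revPerm.trans (Tuple.sort f) with hπ
  have hanti : StrictAnti (f ∘ π) := by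
    have h1 : StrictMono (f ∘ Tuple.sort f) :=
      (Tuple.monotone_sort f).strictMono_of_injective (hf.comp (Tuple.sort f).injective)
    exact h1.comp_strictAnti Fin.rev_strictAnti
  obtain ⟨μ, hμ⟩ := exists_wedgeIndex_eq hanti
  have h := (ExteriorAlgebra.ιMulti ℚ k).map_perm (fun i => b (f i)) π
  have h2 : ExteriorAlgebra.ιMulti ℚ k ((fun i => b (f i)) ∘ π) = wedgeB μ := by
    rw [wedgeB_eq, hμ]
    rfl
  rw [h2] at h
  have h3 : ExteriorAlgebra.ιMulti ℚ k (fun i => b (f i)) =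
      Equiv.Perm.sign π • wedgeB μ := by
    rw [h, smul_smul, Int.units_mul_self, one_smul]
  rw [h3, Units.smul_def]
  exact Submodule.smul_of_tower_mem _ _ (Submodule.subset_span ⟨μ, rfl⟩)

theorem span_wedgeB (k : ℕ) :
    Submodule.span ℚ (Set.range fun μ : Parts k => wedgeB μ) = ⋀[ℚ]^k V := by
  rw [← ExteriorAlgebra.ιMulti_span_fixedDegree]
  apply le_antisymm
  · refine Submodule.span_mono ?_
    rintro _ ⟨μ, rfl⟩
    exact ⟨_, (wedgeB_eq μ).symm⟩
  · rw [Submodule.span_le]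
    rintro _ ⟨v, rfl⟩
    set S := Submodule.span ℚ (Set.range fun μ : Parts k => wedgeB μ) with hS
    -- An alternating map into the quotient by `S` is determined by its values on injective tuples
    -- of basis vectors, and sorting puts those wedges into `S`.
    have h : S.mkQ.compAlternatingMap (ExteriorAlgebra.ιMulti ℚ k) = 0 := by
      refine Module.Basis.ext_alternating (Finsupp.basisSingleOne (R := ℚ) (ι := ℕ)) ?_
      intro f hf
      have := ιMulti_b_mem_span hf
      simpa [b] using this
    have h2 := DFunLike.congr_fun h v
    simpa using h2

/-! ### Reindexing of iterated convolution sums. -/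

section Antidiagonal

variable {M N : Type*} [AddCommMonoid M] [HasAntidiagonal M] [AddCommMonoid N]

theorem sum_antidiagonal_assoc (n : M) (f : M → M → M → N) :
    ∑ p ∈ antidiagonal n, ∑ q ∈ antidiagonal p.1, f q.1 q.2 p.2 =
      ∑ p ∈ antidiagonal n, ∑ q ∈ antidiagonal p.2, f p.1 q.1 q.2 := by
  rw [sum_sigma', sum_sigma']
  refine sum_nbij' (fun x => ⟨(x.2.1, x.2.2 + x.1.2), (x.2.2, x.1.2)⟩)
    (fun x => ⟨(x.1.1 + x.2.1, x.2.2), (x.1.1, x.2.1)⟩) ?_ ?_ ?_ ?_ ?_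
  · rintro ⟨⟨a, c⟩, ⟨d, e⟩⟩
    simp only [mem_sigma, HasAntidiagonal.mem_antidiagonal, and_true]
    rintro ⟨rfl, rfl⟩
    exact (add_assoc _ _ _).symm
  · rintro ⟨⟨a, c⟩, ⟨d, e⟩⟩
    simp only [mem_sigma, HasAntidiagonal.mem_antidiagonal, and_true]
    rintro ⟨rfl, rfl⟩
    exact add_assoc _ _ _
  · rintro ⟨⟨a, c⟩, ⟨d, e⟩⟩
    simp only [mem_sigma, HasAntidiagonal.mem_antidiagonal]
    rintro ⟨rfl, rfl⟩
    rfl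
  · rintro ⟨⟨a, c⟩, ⟨d, e⟩⟩
    simp only [mem_sigma, HasAntidiagonal.mem_antidiagonal]
    rintro ⟨rfl, rfl⟩
    rfl
  · intros
    rfl

theorem sum_antidiagonal_left_comm (n : M) (f : M → M → M → N) :
    ∑ p ∈ antidiagonal n, ∑ q ∈ antidiagonal p.2, f p.1 q.1 q.2 =
      ∑ p ∈ antidiagonal n, ∑ q ∈ antidiagonal p.2, f q.1 p.1 q.2 := by
  rw [← sum_antidiagonal_assoc, ← sum_antidiagonal_assoc n fun i a c => f a i c]
  refine sum_congr rfl fun p _ => ?_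
  conv_lhs => rw [← HasAntidiagonal.map_swap_antidiagonal, sum_map]
  rfl

theorem sum_antidiagonal_four_comm (n : M) (f : M → M → M → M → N) :
    ∑ p ∈ antidiagonal n, ∑ q ∈ antidiagonal p.1, ∑ r ∈ antidiagonal p.2, f q.1 q.2 r.1 r.2 =
      ∑ p ∈ antidiagonal n, ∑ q ∈ antidiagonal p.1, ∑ r ∈ antidiagonal p.2,
        f q.1 r.1 q.2 r.2 := by
  simp only [← sum_product']
  rw [sum_sigma', sum_sigma']
  refine sum_nbij'
    (fun x => ⟨(x.2.1.1 + x.2.2.1, x.2.1.2 + x.2.2.2), ((x.2.1.1, x.2.2.1), (x.2.1.2, x.2.2.2))⟩)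
    (fun x => ⟨(x.2.1.1 + x.2.2.1, x.2.1.2 + x.2.2.2), ((x.2.1.1, x.2.2.1), (x.2.1.2, x.2.2.2))⟩)
    ?_ ?_ ?_ ?_ ?_
  case refine_5 => exact fun _ _ => rfl
  all_goals
    rintro ⟨⟨a, c⟩, ⟨⟨d, e⟩, ⟨g, h⟩⟩⟩
    simp only [mem_sigma, mem_product, HasAntidiagonal.mem_antidiagonal, and_true]
    rintro ⟨rfl, rfl, rfl⟩
  · exact add_add_add_comm _ _ _ _
  · exact add_add_add_comm _ _ _ _
  · rfl
  · rfl

theorem nsmul_cancel [Module ℚ N] {n : ℕ} (hn : n ≠ 0) {x y : N} (h : n • x = n • y) : x = y := by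
  have h2 := congrArg (fun z => (n : ℚ)⁻¹ • z) h
  simpa [← Nat.cast_smul_eq_nsmul ℚ, smul_smul, hn] using h2

end Antidiagonal

/-! ### The differential equation of the exponential series. -/

section Exponential

variable {A : Type*} [Ring A]

/-- The Euler operator `z d/dz` on power series. -/
noncomputable def eulerOp (f : PowerSeries A) : PowerSeries A :=
  PowerSeries.mk fun n => n • PowerSeries.coeff n f

theorem coeff_eulerOp (f : PowerSeries A) (n : ℕ) :
    PowerSeries.coeff n (eulerOp f) = n • PowerSeries.coeff n f := PowerSeries.coeff_mk _ _

theorem eulerOp_mul (f g : PowerSeries A) :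
    eulerOp (f * g) = eulerOp f * g + f * eulerOp g := by
  ext n
  simp only [coeff_eulerOp, map_add, PowerSeries.coeff_mul, smul_sum, ← sum_add_distrib]
  refine sum_congr rfl fun p hp => ?_
  rw [← HasAntidiagonal.mem_antidiagonal.1 hp, smul_mul_assoc, mul_smul_comm, add_smul]

theorem eulerOp_pow_succ {f : PowerSeries A} (hf : Commute (eulerOp f) f) (n : ℕ) :
    eulerOp (f ^ (n + 1)) = (n + 1) • (eulerOp f * f ^ n) := by
  induction n with
  | zero => simp
  | succ n ih =>
    rw [pow_succ' f (n + 1), eulerOp_mul, ih, mul_smul_comm, ← mul_assoc, ← hf.eq, mul_assoc,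
      ← pow_succ', ← succ_nsmul']

theorem commute_of_commute_coeff {f g : PowerSeries A}
    (h : ∀ i j, Commute (PowerSeries.coeff i f) (PowerSeries.coeff j g)) : Commute f g := by
  ext n
  rw [PowerSeries.coeff_mul, PowerSeries.coeff_mul, ← Finset.Nat.sum_antidiagonal_swap]
  exact sum_congr rfl fun p _ => h _ _

theorem coeff_pow_eq_zero {f : PowerSeries A} (hf : PowerSeries.coeff 0 f = 0) {m n : ℕ}
    (h : m < n) : PowerSeries.coeff m (f ^ n) = 0 := by
  refine PowerSeries.coeff_of_lt_order _ (lt_of_lt_of_le ?_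
    (PowerSeries.le_order_pow_of_constantCoeff_eq_zero n (by simpa using hf)))
  exact_mod_cast h

variable [Algebra ℚ A]

theorem coeff_expSeries_eq_sum {S : PowerSeries A} (hS : PowerSeries.coeff 0 S = 0) {m N : ℕ}
    (h : m < N) : PowerSeries.coeff m (expSeries S) =
      ∑ n ∈ range N, (1 / (n.factorial : ℚ)) • PowerSeries.coeff m (S ^ n) := by
  rw [expSeries, PowerSeries.coeff_mk]
  refine sum_subset (Finset.range_subset_range.2 h) fun n _ hn => ?_
  rw [coeff_pow_eq_zero hS (by rw [mem_range] at hn; omega), smul_zero]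

/-- Termwise, `z d/dz` sends `S^(n+1)/(n+1)!` to `(z S') S^n/n!`. The ring is noncommutative, so
this needs `S` to commute with `z S'`, which `hc` provides. -/
theorem eulerOp_expSeries {S : PowerSeries A} (hS : PowerSeries.coeff 0 S = 0)
    (hc : ∀ i j, Commute (PowerSeries.coeff i S) (PowerSeries.coeff j S)) :
    eulerOp (expSeries S) = eulerOp S * expSeries S := by
  have hcomm : Commute (eulerOp S) S := commute_of_commute_coeff fun i j => by
    rw [coeff_eulerOp]
    exact (hc i j).smul_left i
  ext m
  -- One extra term is taken, so that after the vanishing term `n = 0` is split off the range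
  -- matches that of the right-hand side.
  rw [coeff_eulerOp, coeff_expSeries_eq_sum hS (show m < m + 1 + 1 by omega), smul_sum,
    sum_range_succ']
  have h0 : m • (1 / ((Nat.factorial 0 : ℕ) : ℚ)) • PowerSeries.coeff m (S ^ 0) = 0 := by
    rcases Nat.eq_zero_or_pos m with rfl | hm
    · simp
    · simp [PowerSeries.coeff_one, hm.ne']
  rw [h0, add_zero, PowerSeries.coeff_mul]
  have h1 : ∀ p ∈ antidiagonal m, PowerSeries.coeff p.1 (eulerOp S) *
      PowerSeries.coeff p.2 (expSeries S) = ∑ n ∈ range (m + 1), (1 / (n.factorial : ℚ)) •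
        (PowerSeries.coeff p.1 (eulerOp S) * PowerSeries.coeff p.2 (S ^ n)) := by
    intro p hp
    have := HasAntidiagonal.mem_antidiagonal.1 hp
    rw [coeff_expSeries_eq_sum hS (show p.2 < m + 1 by omega), mul_sum]
    exact sum_congr rfl fun n _ => mul_smul_comm _ _ _
  rw [sum_congr rfl h1, sum_comm]
  refine sum_congr rfl fun n _ => ?_
  rw [← smul_sum, ← PowerSeries.coeff_mul, smul_comm, ← coeff_eulerOp, eulerOp_pow_succ hcomm,
    map_nsmul, ← Nat.cast_smul_eq_nsmul ℚ, smul_smul]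
  congr 1
  rw [Nat.factorial_succ]
  push_cast
  field_simp

end Exponential

/-! ### The coefficients of `σ_+(z)`: action on basis vectors and on products. -/

section Derivations

theorem delta_one (φ : Module.End ℚ V) : delta φ 1 = 0 := by
  have h := delta_mul φ 1 1
  simpa using h

theorem shift_pow_b (i j : ℕ) : (shift ^ i) (b j) = b (j + i) := by
  induction i with
  | zero => simp
  | succ i ih => rw [pow_succ', Module.End.mul_apply, ih, shift_b, add_assoc]

/-- Two commuting endomorphisms induce commuting derivations. -/
theorem delta_commute {φ ψ : Module.End ℚ V} (h : Commute φ ψ) :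
    Commute (delta φ) (delta ψ) := by
  refine LinearMap.ext fun u => ?_
  simp only [Module.End.mul_apply]
  induction u using ExteriorAlgebra.induction with
  | algebraMap r => simp [Algebra.algebraMap_eq_smul_one, delta_one]
  | ι v =>
    rw [delta_ι, delta_ι, delta_ι, delta_ι]
    exact congrArg _ (LinearMap.congr_fun h.eq v)
  | mul u w hu hw =>
    simp only [delta_mul, map_add, hu, hw]
    abel
  | add u w hu hw => simp only [map_add, hu, hw]

/-- The coefficient of `z ^ n` in `σ_+(z)`. -/
noncomputable def sigmaCoeff (n : ℕ) : Module.End ℚ ExtV := PowerSeries.coeff n sigmaPlus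

/-- The Euler operator cancels the factors `1/i` in the exponent. All later properties of `σ_+(z)`
use only this recursion and `σ_0 = 1`. -/
theorem nsmul_sigmaCoeff (n : ℕ) : n • sigmaCoeff n =
    ∑ p ∈ antidiagonal n, if p.1 = 0 then 0 else delta (shift ^ p.1) * sigmaCoeff p.2 := by
  have h := congrArg (PowerSeries.coeff n) (eulerOp_expSeries (S := PowerSeries.mk fun i =>
    if i = 0 then 0 else (1 / (i : ℚ)) • delta (shift ^ i)) (by simp) (by
      intro i j
      simp only [PowerSeries.coeff_mk]
      split_ifs
      · exact Commute.zero_left _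
      · exact Commute.zero_left _
      · exact Commute.zero_right _
      · exact ((delta_commute (Commute.pow_pow_self shift i j)).smul_left _).smul_right _))
  rw [coeff_eulerOp, PowerSeries.coeff_mul] at h
  refine h.trans (sum_congr rfl fun p _ => ?_)
  rw [coeff_eulerOp, PowerSeries.coeff_mk]
  split_ifs with hp
  · simp
  · rw [← Nat.cast_smul_eq_nsmul ℚ, smul_smul, mul_one_div_cancel (by exact_mod_cast hp), one_smul]
    rfl

theorem nsmul_sigmaCoeff_apply (n : ℕ) (u : ExtV) : n • sigmaCoeff n u =
    ∑ p ∈ antidiagonal n, if p.1 = 0 then 0 else delta (shift ^ p.1) (sigmaCoeff p.2 u) := by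
  rw [← LinearMap.smul_apply, nsmul_sigmaCoeff, LinearMap.sum_apply]
  refine sum_congr rfl fun p _ => ?_
  split_ifs <;> simp

theorem sigmaCoeff_zero : sigmaCoeff 0 = 1 := by
  simp [sigmaCoeff, sigmaPlus, expSeries]

theorem sigmaCoeff_one (n : ℕ) : sigmaCoeff n 1 = if n = 0 then 1 else 0 := by
  induction n using Nat.strong_induction_on with
  | _ n ih =>
    rcases Nat.eq_zero_or_pos n with rfl | hn
    · simp [sigmaCoeff_zero]
    refine nsmul_cancel hn.ne' ?_
    rw [nsmul_sigmaCoeff_apply, if_neg hn.ne', smul_zero]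
    refine sum_eq_zero fun p hp => ?_
    have hp := HasAntidiagonal.mem_antidiagonal.1 hp
    split_ifs with h0
    · rfl
    · rw [ih p.2 (by omega)]
      split_ifs <;> simp [delta_one]

theorem sigmaCoeff_ι_b (n j : ℕ) :
    sigmaCoeff n (ExteriorAlgebra.ι ℚ (b j)) = ExteriorAlgebra.ι ℚ (b (j + n)) := by
  induction n using Nat.strong_induction_on with
  | _ n ih =>
    rcases n with _ | n
    · simp [sigmaCoeff_zero]
    · refine nsmul_cancel (Nat.succ_ne_zero n) ?_
      rw [nsmul_sigmaCoeff_apply, Finset.Nat.sum_antidiagonal_succ]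
      simp only [if_true, zero_add, Nat.succ_ne_zero, if_false]
      -- All `n + 1` remaining terms are the same vector, which matches the multiple `n + 1` on the
      -- left.
      rw [sum_congr rfl (g := fun _ => ExteriorAlgebra.ι ℚ (b (j + (n + 1))))]
      · simp
      · intro p hp
        have hp := HasAntidiagonal.mem_antidiagonal.1 hp
        rw [ih p.2 (by omega), delta_ι, shift_pow_b]
        congr 2
        omega

theorem sigmaCoeff_list_prod_ι_b (L : List ℕ) (j : ℕ) :
    (L.map sigmaCoeff).prod (ExteriorAlgebra.ι ℚ (b j)) = ExteriorAlgebra.ι ℚ (b (j + L.sum)) := by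
  induction L with
  | nil => simp
  | cons n L ih =>
    rw [List.map_cons, List.prod_cons, Module.End.mul_apply, ih, sigmaCoeff_ι_b, List.sum_cons,
      add_assoc, add_comm n]

/-- Both sides satisfy the same recursion in `n`: on the left because `δ` is a derivation, on the
right because the weight `n = p.1 + p.2` splits over the two factors. -/
theorem sigmaCoeff_mul (n : ℕ) (u w : ExtV) : sigmaCoeff n (u * w) =
    ∑ p ∈ antidiagonal n, sigmaCoeff p.1 u * sigmaCoeff p.2 w := by
  induction n using Nat.strong_induction_on with
  | _ n ih =>
    rcases Nat.eq_zero_or_pos n with rfl | hn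
    · simp [sigmaCoeff_zero]
    refine nsmul_cancel hn.ne' ?_
    have hL : n • sigmaCoeff n (u * w) = ∑ p ∈ antidiagonal n, ∑ q ∈ antidiagonal p.2,
        ((if p.1 = 0 then 0 else delta (shift ^ p.1) (sigmaCoeff q.1 u)) * sigmaCoeff q.2 w +
          sigmaCoeff q.1 u *
            (if p.1 = 0 then 0 else delta (shift ^ p.1) (sigmaCoeff q.2 w))) := by
      rw [nsmul_sigmaCoeff_apply]
      refine sum_congr rfl fun p hp => ?_
      have hp := HasAntidiagonal.mem_antidiagonal.1 hp
      split_ifs with h0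
      · simp
      · rw [ih p.2 (by omega), map_sum]
        exact sum_congr rfl fun q _ => delta_mul _ _ _
    have hR : n • ∑ p ∈ antidiagonal n, sigmaCoeff p.1 u * sigmaCoeff p.2 w =
        ∑ p ∈ antidiagonal n, (p.1 • sigmaCoeff p.1 u) * sigmaCoeff p.2 w +
        ∑ p ∈ antidiagonal n, sigmaCoeff p.1 u * (p.2 • sigmaCoeff p.2 w) := by
      rw [smul_sum, ← sum_add_distrib]
      refine sum_congr rfl fun p hp => ?_
      rw [← HasAntidiagonal.mem_antidiagonal.1 hp, smul_mul_assoc, mul_smul_comm, add_smul]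
    rw [hL, hR]
    simp only [sum_add_distrib, nsmul_sigmaCoeff_apply, sum_mul, mul_sum]
    congr 1
    · exact (sum_antidiagonal_assoc n fun i a c =>
        (if i = 0 then 0 else delta (shift ^ i) (sigmaCoeff a u)) * sigmaCoeff c w).symm
    · exact sum_antidiagonal_left_comm n fun i a c =>
        sigmaCoeff a u * (if i = 0 then 0 else delta (shift ^ i) (sigmaCoeff c w))

end Derivations

/-! ### The Jacobi–Trudi identity. -/

/-- The complete homogeneous symmetric polynomial, as a sum of monomials. -/
noncomputable def completeHomog (k n : ℕ) : MvPolynomial (Fin k) ℚ :=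
  ∑ l ∈ finsuppAntidiag (univ : Finset (Fin k)) n, MvPolynomial.monomial l 1

theorem coeff_completeHomog {k n : ℕ} (m : Fin k →₀ ℕ) :
    MvPolynomial.coeff m (completeHomog k n) = if m.degree = n then 1 else 0 := by
  simp [completeHomog, MvPolynomial.coeff_sum, MvPolynomial.coeff_monomial, Finsupp.degree_eq_sum]

theorem completeHomog_zero (k : ℕ) : completeHomog k 0 = 1 := by
  simp [completeHomog]

/-- The geometric series `1 / (1 - r t)`. -/
noncomputable def geomSeries {R : Type*} [CommRing R] (r : R) : PowerSeries R :=
  PowerSeries.mk fun n => r ^ n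

theorem geomSeries_mul {R : Type*} [CommRing R] (r : R) :
    geomSeries r * (1 - PowerSeries.C r * PowerSeries.X) = 1 := by
  ext n
  rw [mul_sub, mul_one, mul_comm (PowerSeries.C r), ← mul_assoc]
  rcases n with _ | n
  · simp [geomSeries]
  · simp [geomSeries, PowerSeries.coeff_succ_mul_X, PowerSeries.coeff_one, pow_succ]

theorem prod_geomSeries (k : ℕ) :
    ∏ j : Fin k, geomSeries (MvPolynomial.X j : MvPolynomial (Fin k) ℚ) =
      PowerSeries.mk (completeHomog k) := by
  ext1 n
  rw [PowerSeries.coeff_prod, PowerSeries.coeff_mk, completeHomog]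
  refine sum_congr rfl fun l _ => ?_
  rw [MvPolynomial.monomial_eq, Finsupp.prod_fintype _ _ (by simp)]
  simp [geomSeries]

/-- The polynomial `∏_{i ≠ j} (1 - x_i t)` in `t`. -/
noncomputable def elemWithout {k : ℕ} (j : Fin k) : Polynomial (MvPolynomial (Fin k) ℚ) :=
  ∏ i ∈ univ.erase j, (1 - Polynomial.C (MvPolynomial.X i) * Polynomial.X)

theorem natDegree_elemWithout_lt {k : ℕ} (j : Fin k) : (elemWithout j).natDegree < k := by
  have h : (elemWithout j).natDegree ≤ (univ.erase j).card := by
    refine (Polynomial.natDegree_prod_le _ _).trans ((sum_le_card_nsmul _ _ 1 fun i _ => ?_).trans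
      (by simp))
    refine (Polynomial.natDegree_sub_le _ _).trans ?_
    simp only [Polynomial.natDegree_one, zero_le, sup_of_le_right]
    exact (Polynomial.natDegree_C_mul_le _ _).trans Polynomial.natDegree_X_le
  rw [card_erase_of_mem (mem_univ j), card_univ, Fintype.card_fin] at h
  have := j.2
  omega

/-- In `∏_i 1/(1 - x_i t)` every factor except that of `x_j` is cancelled. -/
theorem completeHomog_mul_elemWithout {k : ℕ} (j : Fin k) :
    PowerSeries.mk (completeHomog k) * (elemWithout j : PowerSeries (MvPolynomial (Fin k) ℚ)) =
      geomSeries (MvPolynomial.X j) := by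
  have h : (elemWithout j : PowerSeries (MvPolynomial (Fin k) ℚ)) =
      ∏ i ∈ univ.erase j, (1 - PowerSeries.C (MvPolynomial.X i) * PowerSeries.X) := by
    change Polynomial.coeToPowerSeries.ringHom (elemWithout j) = _
    rw [elemWithout, map_prod]
    simp
  rw [← prod_geomSeries, h, ← mul_prod_erase univ _ (mem_univ j), mul_assoc, ← prod_mul_distrib]
  simp [geomSeries_mul]

/-- `h_{a-l}`, with the convention that it vanishes for `a < l`. -/
noncomputable def completeHomogSub (k a l : ℕ) : MvPolynomial (Fin k) ℚ :=
  if l ≤ a then completeHomog k (a - l) else 0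

theorem sum_completeHomogSub_mul {k : ℕ} (a : ℕ) (j : Fin k) :
    ∑ l : Fin k, completeHomogSub k a l * (elemWithout j).coeff l = MvPolynomial.X j ^ a := by
  have h := congrArg (PowerSeries.coeff a) (completeHomog_mul_elemWithout j)
  rw [geomSeries, PowerSeries.coeff_mk, PowerSeries.coeff_mul] at h
  rw [← h, ← Finset.Nat.sum_antidiagonal_swap,
    Finset.Nat.sum_antidiagonal_eq_sum_range_succ_mk,
    ← Finset.sum_range fun l => completeHomogSub k a l * (elemWithout j).coeff l]
  simp only [completeHomogSub, PowerSeries.coeff_mk, Polynomial.coeff_coe, Prod.fst_swap,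
    Prod.snd_swap, ite_mul, zero_mul]
  rw [← sum_filter, ← sum_filter_of_ne (s := range a.succ) (p := fun l => l < k)]
  · refine sum_congr ?_ fun _ _ => rfl
    ext l
    simp only [mem_filter, mem_range]
    omega
  · intro l _ hl
    by_contra hlk
    refine hl ?_
    rw [Polynomial.coeff_eq_zero_of_natDegree_lt, mul_zero]
    have := natDegree_elemWithout_lt j
    omega

/-- Comparing coefficients of `t^a` writes `x_j^a` as a sum over `l < k`, so the alternant matrix
factors into two square matrices, the second independent of `μ`. For `μ = 0` the first is
unitriangular, so the second determinant is `Δ_0`. -/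
theorem alternant_eq_det_mul {k : ℕ} (μ : Parts k) :
    alternant μ = Matrix.det (Matrix.of fun i l : Fin k =>
        completeHomogSub k (μ.1 (Fin.rev i) + (i : ℕ)) l) *
      Matrix.det (Matrix.of fun l j : Fin k => (elemWithout j).coeff (l : ℕ)) := by
  rw [← Matrix.det_mul, alternant]
  congr 1
  ext1 i j
  simp [Matrix.mul_apply, sum_completeHomogSub_mul]

theorem alternant_zero_eq_det (k : ℕ) : alternant (zeroPart k) =
    Matrix.det (Matrix.of fun l j : Fin k => (elemWithout j).coeff (l : ℕ)) := by
  rw [alternant_eq_det_mul, Matrix.det_of_isLowerTriangular, prod_eq_one, one_mul]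
  · intro i _
    simp [completeHomogSub, zeroPart, completeHomog_zero]
  · intro i l hil
    have h : (i : ℕ) < l := hil
    exact if_neg (by simpa [zeroPart] using h)

/-- The Jacobi–Trudi identity. -/
theorem schur_eq_det {k : ℕ} (μ : Parts k) : schur μ =
    Matrix.det (Matrix.of fun i j : Fin k =>
      completeHomogSub k (wedgeIndex μ j) (wedgeIndex (zeroPart k) i)) := by
  have h := schur_spec μ
  rw [alternant_eq_det_mul, ← alternant_zero_eq_det] at h
  -- Transposing and reversing both index sets passes from the increasing exponents of the alternant
  -- to the decreasing indices of the wedge.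
  rw [← mul_right_cancel₀ (alternant_zero_ne_zero k) h, ← Matrix.det_transpose,
    ← Matrix.det_submatrix_equiv_self Fin.revPerm]
  congr 1
  ext1 i j
  have hi := i.2
  have hj := j.2
  simp only [Matrix.submatrix_apply, Matrix.transpose_apply, Matrix.of_apply, wedgeIndex, zeroPart,
    Fin.revPerm_apply, Fin.rev_rev, Fin.val_rev]
  congr 1 <;> omega

/-! ### Ordered products of noncommutative series, and multiplicative series of endomorphisms. -/

theorem coeff_list_ofFn_prod {A σ : Type*} [Semiring A] [DecidableEq σ] (n : ℕ)
    (F : Fin n → MvPowerSeries σ A) (m : σ →₀ ℕ) :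
    MvPowerSeries.coeff m (List.ofFn F).prod = ∑ f ∈ finAntidiagonal n m,
      (List.ofFn fun i => MvPowerSeries.coeff (f i) (F i)).prod := by
  induction n generalizing m with
  | zero =>
    by_cases hm : m = 0
    · subst hm
      have : finAntidiagonal 0 (0 : σ →₀ ℕ) = univ := by
        ext f
        simpa using Subsingleton.elim _ _
      simp [this]
    · have : finAntidiagonal 0 m = ∅ := by
        ext f
        simp [Ne.symm hm]
      simp [this, MvPowerSeries.coeff_one, hm]
  | succ n ih =>
    rw [List.ofFn_succ, List.prod_cons, MvPowerSeries.coeff_mul]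
    simp only [ih, mul_sum]
    rw [sum_sigma']
    refine sum_bij' (fun x _ => Fin.cons x.1.1 x.2)
      (fun f _ => ⟨(f 0, ∑ i, Fin.tail f i), Fin.tail f⟩) ?_ ?_ ?_ ?_ ?_
    · rintro ⟨⟨a, c⟩, f⟩
      simp only [mem_sigma, HasAntidiagonal.mem_antidiagonal, mem_finAntidiagonal]
      rintro ⟨rfl, rfl⟩
      simp [Fin.sum_univ_succ]
    · intro f
      simp [Fin.sum_univ_succ, Fin.tail]
    · rintro ⟨⟨a, c⟩, f⟩
      simp only [mem_sigma, HasAntidiagonal.mem_antidiagonal, mem_finAntidiagonal]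
      rintro ⟨rfl, rfl⟩
      simp
    · intro f _
      simp
    · rintro ⟨⟨a, c⟩, f⟩ _
      simp [List.ofFn_succ]

theorem coeff_inVar {A : Type*} [Semiring A] {k : ℕ} (j : Fin k) (D : PowerSeries A)
    (m : Fin k →₀ ℕ) : MvPowerSeries.coeff m (inVar j D) =
      if m = Finsupp.single j (m j) then PowerSeries.coeff (m j) D else 0 := rfl

/-- The `j`-th factor involves only `z_j`, so a single splitting of `m` contributes. -/
theorem coeff_list_ofFn_inVar_prod {A : Type*} [Semiring A] {k : ℕ} (D : PowerSeries A)
    (m : Fin k →₀ ℕ) :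
    MvPowerSeries.coeff m (List.ofFn fun j : Fin k => inVar j D).prod =
      (List.ofFn fun j : Fin k => PowerSeries.coeff (m j) D).prod := by
  rw [coeff_list_ofFn_prod, sum_eq_single fun j => Finsupp.single j (m j)]
  · simp [coeff_inVar]
  · intro f hf hne
    rw [mem_finAntidiagonal] at hf
    obtain ⟨j, hj⟩ : ∃ j, f j ≠ Finsupp.single j (f j j) := by
      by_contra! hall
      refine hne (funext fun j => ?_)
      rw [hall j]
      congr 1
      rw [← hf, Finsupp.finsetSum_apply, sum_eq_single j]
      · intro i _ hij
        rw [hall i, Finsupp.single_eq_of_ne (Ne.symm hij)]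
      · simp
    refine List.prod_eq_zero ((List.mem_ofFn' _ _).2 ⟨j, ?_⟩)
    exact if_neg hj
  · intro h
    refine absurd ?_ h
    rw [mem_finAntidiagonal]
    exact Finsupp.univ_sum_single m

/-- A series `D` of endomorphisms of an algebra with `D 1 = 1` and `D (u w) = D u · D w`. -/
structure IsMultiplicative {σ A : Type*} [Ring A] [Algebra ℚ A] [DecidableEq σ]
    (D : MvPowerSeries σ (Module.End ℚ A)) : Prop where
  map_one : applySeries D 1 = 1
  map_mul : ∀ u w : A, applySeries D (u * w) = applySeries D u * applySeries D w

section Multiplicative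

variable {σ A : Type*} [Ring A] [Algebra ℚ A] [DecidableEq σ]

theorem IsMultiplicative.coeff_one {D : MvPowerSeries σ (Module.End ℚ A)}
    (hD : IsMultiplicative D) (m : σ →₀ ℕ) :
    MvPowerSeries.coeff m D 1 = MvPowerSeries.coeff m (1 : MvPowerSeries σ A) :=
  congrFun hD.map_one m

theorem IsMultiplicative.coeff_mul {D : MvPowerSeries σ (Module.End ℚ A)}
    (hD : IsMultiplicative D) (m : σ →₀ ℕ) (u w : A) : MvPowerSeries.coeff m D (u * w) =
      ∑ p ∈ antidiagonal m, MvPowerSeries.coeff p.1 D u * MvPowerSeries.coeff p.2 D w :=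
  (congrFun (hD.map_mul u w) m).trans (MvPowerSeries.coeff_mul _ _ _)

theorem isMultiplicative_one : IsMultiplicative (1 : MvPowerSeries σ (Module.End ℚ A)) := by
  have h : ∀ u : A, applySeries (1 : MvPowerSeries σ (Module.End ℚ A)) u = MvPowerSeries.C u := by
    intro u
    ext m
    change MvPowerSeries.coeff m (1 : MvPowerSeries σ (Module.End ℚ A)) u = _
    rw [MvPowerSeries.coeff_one, MvPowerSeries.coeff_C]
    split_ifs <;> rfl
  exact ⟨by rw [h, _root_.map_one], fun u w => by rw [h, h, h, _root_.map_mul]⟩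

theorem IsMultiplicative.mul {D E : MvPowerSeries σ (Module.End ℚ A)}
    (hD : IsMultiplicative D) (hE : IsMultiplicative E) : IsMultiplicative (D * E) := by
  constructor
  · ext m
    rw [← one_mul (1 : MvPowerSeries σ A), MvPowerSeries.coeff_mul]
    change MvPowerSeries.coeff m (D * E) 1 = _
    rw [MvPowerSeries.coeff_mul, LinearMap.sum_apply]
    refine sum_congr rfl fun p _ => ?_
    rw [Module.End.mul_apply, hE.coeff_one, MvPowerSeries.coeff_one (n := p.2)]
    split_ifs
    · rw [hD.coeff_one, mul_one]
    · rw [map_zero, mul_zero]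
  · intro u w
    ext m
    rw [MvPowerSeries.coeff_mul]
    change MvPowerSeries.coeff m (D * E) (u * w) =
      ∑ p ∈ antidiagonal m, MvPowerSeries.coeff p.1 (D * E) u * MvPowerSeries.coeff p.2 (D * E) w
    simp only [MvPowerSeries.coeff_mul, LinearMap.sum_apply, Module.End.mul_apply, sum_mul_sum]
    -- Exchanging the middle indices groups the two `E`-exponents and the two `D`-exponents, so that
    -- multiplicativity of `E`, then of `D`, applies.
    rw [sum_antidiagonal_four_comm m fun a c d e =>
      MvPowerSeries.coeff a D (MvPowerSeries.coeff c E u) *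
        MvPowerSeries.coeff d D (MvPowerSeries.coeff e E w)]
    refine sum_congr rfl fun p _ => ?_
    rw [hE.coeff_mul, map_sum, sum_comm]
    exact sum_congr rfl fun q _ => hD.coeff_mul _ _ _

theorem IsMultiplicative.list_prod {L : List (MvPowerSeries σ (Module.End ℚ A))}
    (h : ∀ D ∈ L, IsMultiplicative D) : IsMultiplicative L.prod := by
  induction L with
  | nil => exact isMultiplicative_one
  | cons D L ih =>
    rw [List.prod_cons]
    exact (h D (by simp)).mul (ih fun E hE => h E (by simp [hE]))

theorem IsMultiplicative.map_list_prod {D : MvPowerSeries σ (Module.End ℚ A)}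
    (hD : IsMultiplicative D) (L : List A) :
    applySeries D L.prod = (L.map (applySeries D)).prod := by
  induction L with
  | nil => exact hD.map_one
  | cons u L ih => rw [List.prod_cons, hD.map_mul, ih, List.map_cons, List.prod_cons]

end Multiplicative

theorem inVar_sigmaPlus_isMultiplicative {k : ℕ} (j : Fin k) :
    IsMultiplicative (inVar j sigmaPlus) := by
  constructor
  · ext m
    change MvPowerSeries.coeff m (inVar j sigmaPlus) 1 = _
    rw [coeff_inVar, MvPowerSeries.coeff_one]
    split_ifs with hm h0 h0
    · subst h0
      exact (sigmaCoeff_one _).trans (if_pos rfl)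
    · refine (sigmaCoeff_one _).trans (if_neg fun h => h0 ?_)
      rw [hm, h, Finsupp.single_zero]
    · subst h0
      simp at hm
    · rfl
  · intro u w
    ext m
    rw [MvPowerSeries.coeff_mul]
    change MvPowerSeries.coeff m (inVar j sigmaPlus) (u * w) = ∑ p ∈ antidiagonal m,
      MvPowerSeries.coeff p.1 (inVar j sigmaPlus) u * MvPowerSeries.coeff p.2 (inVar j sigmaPlus) w
    simp only [coeff_inVar]
    split_ifs with hm
    · rw [hm, Finsupp.antidiagonal_single, sum_map, Finsupp.single_eq_same]
      simpa [sigmaCoeff] using sigmaCoeff_mul (m j) u w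
    · symm
      rw [LinearMap.zero_apply]
      refine sum_eq_zero fun p hp => ?_
      rw [HasAntidiagonal.mem_antidiagonal] at hp
      split_ifs with h1 h2
      · refine absurd ?_ hm
        rw [← hp, Finsupp.add_apply, Finsupp.single_add, ← h1, ← h2]
      all_goals simp

theorem sigmaPlusMulti_isMultiplicative (k : ℕ) : IsMultiplicative (sigmaPlusMulti k) := by
  refine IsMultiplicative.list_prod fun D hD => ?_
  obtain ⟨j, rfl⟩ := (List.mem_ofFn' _ _).1 hD
  exact inVar_sigmaPlus_isMultiplicative j

/-! ### Comparison of coefficients in the generating function. -/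

theorem coeff_sigmaPlusMulti_ι_b {k : ℕ} (m : Fin k →₀ ℕ) (j : ℕ) :
    MvPowerSeries.coeff m (sigmaPlusMulti k) (ExteriorAlgebra.ι ℚ (b j)) =
      ExteriorAlgebra.ι ℚ (b (j + m.degree)) := by
  have h : (List.ofFn fun i : Fin k => PowerSeries.coeff (m i) sigmaPlus) =
      (List.ofFn m).map sigmaCoeff := by
    rw [List.map_ofFn]
    rfl
  rw [sigmaPlusMulti, coeff_list_ofFn_inVar_prod, h, sigmaCoeff_list_prod_ι_b, List.sum_ofFn,
    Finsupp.degree_eq_sum]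

theorem coeff_sigmaPlusMulti_ιMulti {k : ℕ} (m : Fin k →₀ ℕ) (a : Fin k → ℕ) :
    MvPowerSeries.coeff m (sigmaPlusMulti k) (ExteriorAlgebra.ιMulti ℚ k fun i => b (a i)) =
      ∑ f ∈ finAntidiagonal k m,
        ExteriorAlgebra.ιMulti ℚ k fun i => b (a i + (f i).degree) := by
  have h := (sigmaPlusMulti_isMultiplicative k).map_list_prod
    (List.ofFn fun i => ExteriorAlgebra.ι ℚ (b (a i)))
  rw [← ExteriorAlgebra.ιMulti_apply, List.map_ofFn] at h
  refine (congrFun h m).trans ((coeff_list_ofFn_prod _ _ _).trans (sum_congr rfl fun f _ => ?_))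
  rw [ExteriorAlgebra.ιMulti_apply]
  congr 2
  funext i
  exact coeff_sigmaPlusMulti_ι_b _ _

theorem coeff_prod_fin {k : ℕ} {R : Type*} [CommSemiring R] {σ : Type*} [DecidableEq σ]
    (F : Fin k → MvPolynomial σ R) (m : σ →₀ ℕ) :
    MvPolynomial.coeff m (∏ i, F i) =
      ∑ f ∈ finAntidiagonal k m, ∏ i, MvPolynomial.coeff (f i) (F i) := by
  have h := coeff_list_ofFn_prod k (fun i => (F i : MvPowerSeries σ R)) m
  simp only [List.prod_ofFn, MvPolynomial.coeff_coe] at h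
  rw [← h, ← MvPolynomial.coeff_coe]
  congr 1
  exact _root_.map_prod MvPolynomial.coeToMvPowerSeries.ringHom F univ

theorem coeff_completeHomogSub {k a l : ℕ} (m : Fin k →₀ ℕ) :
    MvPolynomial.coeff m (completeHomogSub k a l) = if l + m.degree = a then 1 else 0 := by
  rw [completeHomogSub]
  split_ifs with h1 h2 h2
  · rw [coeff_completeHomog, if_pos (by omega)]
  · rw [coeff_completeHomog, if_neg (by omega)]
  · omega
  · simp

/-- Both sides expand into the same double sum, over permutations and over splittings of `m` into
`k` exponents: a monomial occurs in `h_{a-l}` exactly when its degree shifts `b_l` to `b_a`. -/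
theorem wedgeCoord_sigmaPlusMulti {k : ℕ} (μ : Parts k) (m : Fin k →₀ ℕ) :
    wedgeCoord μ (MvPowerSeries.coeff m (sigmaPlusMulti k) (wedgeB (zeroPart k))) =
      MvPolynomial.coeff m (schur μ) := by
  have hterm : ∀ π : Equiv.Perm (Fin k), MvPolynomial.coeff m (Equiv.Perm.sign π •
      ∏ i, completeHomogSub k (wedgeIndex μ (π i)) (wedgeIndex (zeroPart k) i)) =
      ∑ f ∈ finAntidiagonal k m, Equiv.Perm.sign π • ∏ i,
        if wedgeIndex (zeroPart k) i + (f i).degree = wedgeIndex μ (π i) then (1 : ℚ) else 0 := by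
    intro π
    rw [Units.smul_def, MvPolynomial.coeff_smul, coeff_prod_fin, smul_sum]
    simp only [coeff_completeHomogSub, Units.smul_def]
  rw [wedgeB_eq, coeff_sigmaPlusMulti_ιMulti, map_sum, schur_eq_det, ← Matrix.det_transpose,
    Matrix.det_apply, MvPolynomial.coeff_sum]
  refine Eq.trans ?_ (sum_congr rfl fun π _ => hterm π).symm
  rw [sum_comm]
  refine sum_congr rfl fun f _ => ?_
  rw [wedgeCoord_ιMulti, ← Matrix.det_transpose, Matrix.det_apply]
  rfl

theorem coeff_sigmaPlusMulti_mem {k : ℕ} (m : Fin k →₀ ℕ) :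
    MvPowerSeries.coeff m (sigmaPlusMulti k) (wedgeB (zeroPart k)) ∈
      Submodule.span ℚ (Set.range fun μ : Parts k => wedgeB μ) := by
  rw [span_wedgeB, ← ExteriorAlgebra.ιMulti_span_fixedDegree, wedgeB_eq,
    coeff_sigmaPlusMulti_ιMulti]
  exact Submodule.sum_mem _ fun f _ => Submodule.subset_span ⟨_, rfl⟩

theorem hasFormalSum_schur (k : ℕ) : HasFormalSum
    (fun μ : Parts k => polySMul (schur μ) (wedgeB μ))
    (applySeries (sigmaPlusMulti k) (wedgeB (zeroPart k))) := by
  let _ : TopologicalSpace ExtV := ⊥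
  refine Pi.hasSum.2 fun m => ?_
  -- The finite support of `c` supplies the finiteness of the sum at the monomial `m`; the
  -- coordinate functionals then identify `c μ` with the coefficient of `s_μ`.
  obtain ⟨c, hc⟩ := Finsupp.mem_span_range_iff_exists_finsupp.1 (coeff_sigmaPlusMulti_mem m)
  have hcoef : ∀ μ, MvPolynomial.coeff m (schur μ) = c μ := by
    intro μ
    rw [← wedgeCoord_sigmaPlusMulti, ← hc, Finsupp.sum, map_sum]
    simp only [map_smul, wedgeCoord_wedgeB, smul_eq_mul, mul_ite, mul_one, mul_zero]
    rw [sum_ite_eq]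
    split_ifs with h
    · rfl
    · exact (Finsupp.notMem_support_iff.1 h).symm
  change HasSum (fun μ => MvPolynomial.coeff m (schur μ) • wedgeB μ)
    (MvPowerSeries.coeff m (sigmaPlusMulti k) (wedgeB (zeroPart k)))
  simp only [hcoef]
  rw [← hc]
  refine hasSum_sum_of_ne_finset_zero fun μ hμ => ?_
  rw [Finsupp.notMem_support_iff.1 hμ, zero_smul]

end SchubertGen

theorem mainTheorem10 (k : ℕ) :
    (LinearIndependent ℚ (fun μ : SchubertGen.Parts k => SchubertGen.wedgeB μ) ∧
      Submodule.span ℚ (Set.range fun μ : SchubertGen.Parts k => SchubertGen.wedgeB μ) =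
        ⋀[ℚ]^k SchubertGen.V) ∧
    SchubertGen.HasFormalSum
      (fun μ : SchubertGen.Parts k =>
        SchubertGen.polySMul (SchubertGen.schur μ) (SchubertGen.wedgeB μ))
      (SchubertGen.applySeries (SchubertGen.sigmaPlusMulti k)
        (SchubertGen.wedgeB (SchubertGen.zeroPart k))) :=
  ⟨⟨SchubertGen.wedgeB_linearIndependent k, SchubertGen.span_wedgeB k⟩,
    SchubertGen.hasFormalSum_schur k⟩
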